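/- Let $k\ge 1$, let $\Sigma_k$ be an alphabet with $k$ letters, write $\lambda$ for the empty word and $\alpha\sqsubseteq\beta$ if the word $\alpha$ is a prefix of the word $\beta$. Indices $i,j,a,b$ range over $\{0,1,2,\dots\}$. A $k$-heap tableau is a partial function $T:\Sigma_k^*\times\mathbb N\rightharpoonup\mathbb N$ with finite domain $\mathrm{dom}(T)$ such that (i) if $(r,a)\in \mathrm{dom}(T)$ and $q\sqsubseteq r$ then $(q,a)\in\mathrm{dom}(T)$ and $T(q,a)\le T(r,a)$; (ii) if $(r,a)\in\mathrm{dom}(T)$ and $b<a$ then $(r,b)\in\mathrm{dom}(T)$ and $T(r,b)<T(r,a)$. Its shape is the function $r\mapsto |V_r|$, where $V_r$ is the vector of the values $T(r,0),T(r,1),\dots$ that are defined. A $k$-shape is a finitely supported function $S:\Sigma_k^*\to\mathbb N$ with $S(r)\le S(q)$ whenever $q\sqsubseteq r$; its cells are the pairs $(r,a)$ with $a<S(r)$, and $n$ denotes their number. Let $N(S)$ be the number of $k$-heap tableaux of shape $S$ in which each of $1,\dots,n$ occurs exactly once. The hook length $H_{\alpha,i}$ of a cell $(\alpha,i)$ is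 the number of cells $(\beta,j)$ with ($j=i$ and $\alpha\sqsubseteq\beta$) or ($j\ge i$ and $\beta=\alpha$). Put $F(S)=n!/\prod_{(\alpha,i)}H_{\alpha,i}$, the product being over all cells of $S$; the bound is called tight for $S$ if $N(S)=F(S)$. Theorem. 1. For every $k\ge2$ and every $k$-shape $S$, $N(S)\ge F(S)$. 2. For $k\ge2$, the bound is tight for Young tableaux, i.e. for every shape obtained from a Young diagram $\mu$ and an infinite word $w$ over $\Sigma_k$ by letting $S(r)$ be the length of the $j$-th column of $\mu$ if $r$ is the prefix of length $j$ of $w$ ($j=0,1,2,\dots$), and $S(r)=0$ for all other words $r$. 3. For $k\ge2$, the bound is tight for heap-ordered trees, i.e. for every $k$-shape $S$ with $S(r)\le 1$ for all $r$. 4. For $r\ge2$ and $k\ge1$ let $T_{r,k}$ be the $k$-shape with $T_{r,k}(\lambda)=k$, $T_{r,k}(\alpha)=1$ for $1\le|\alpha|<r$ and $T_{r,k}(\alpha)=0$ for $|\alpha|\ge r$ (a complete $k$-ary tree with $r$ levels as first heap, followed by $k-1$ one-element heaps). The bound is tight for all $T_{r,k}$. For each $k\ge2$, the family $(T_{r,k})_{r\ge2}$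 consists of infinitely many shapes, none of which is of the kind described in 2 or 3. 5. For $k\ge2$ let $x,y$ be the first two letters of $\Sigma_k$, and for $r\ge2$ let $W_r$ be the $k$-shape whose cells are $(\lambda,0)$, $(x,0)$, $(y,0)$, $(yy,0)$, $\dots$, $(y^{2r-3},0)$ and $(\lambda,1)$, $(x,1)$. The bound is not tight for any $W_r$, and there are infinitely many shapes $W_r$. -/

import Mathlib

open scoped Nat

namespace HeapTableaux

/-- A `k`-shape: a finitely supported assignment of a length `len r` to every word `r` over the
`k`-letter alphabet `Fin k`, which does not increase from a word to its extensions. The number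
`len r` is the length of the vector placed at address `r` (zero if there is none). -/
@[ext]
structure Shape (k : ℕ) where
  /-- the length of the vector at each address -/
  len : List (Fin k) → ℕ
  finite_support : {r | len r ≠ 0}.Finite
  anti : ∀ q r : List (Fin k), q <+: r → len r ≤ len q

/-- A `k`-heap tableau: a partial function from (address, index) pairs to natural numbers (`none`
is the empty cell) with finite domain, such that for each index the values form a min-heap on a
prefix-closed set of addresses and such that each vector is an increasing initial segment.
Indices start from `0`, so index `a` belongs to the `(a+1)`-st heap. -/
@[ext]
structure HeapTableau (k : ℕ) where
  /-- the content of each cell -/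
  val : List (Fin k) × ℕ → Option ℕ
  finite_dom : {c | val c ≠ none}.Finite
  heap : ∀ (q r : List (Fin k)) (a x : ℕ), val (r, a) = some x → q <+: r →
    ∃ y, val (q, a) = some y ∧ y ≤ x
  vec : ∀ (r : List (Fin k)) (a b x : ℕ), val (r, a) = some x → b < a →
    ∃ y, val (r, b) = some y ∧ y < x

namespace HeapTableau

variable {k : ℕ}

/-- The indices of the nonempty cells of the vector at address `r`. -/
def vecDom (T : HeapTableau k) (r : List (Fin k)) : Set ℕ := {a | T.val (r, a) ≠ none}

theorem vecDom_finite (T : HeapTableau k) (r : List (Fin k)) : (T.vecDom r).Finite := by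
  refine (T.finite_dom.image Prod.snd).subset ?_
  intro a ha
  exact ⟨(r, a), ha, rfl⟩

/-- The shape of a heap tableau: address `r` is labelled with the length of the vector at `r`. -/
noncomputable def shape (T : HeapTableau k) : Shape k where
  len r := (T.vecDom r).ncard
  finite_support := by
    refine (T.finite_dom.image Prod.fst).subset ?_
    intro r hr
    obtain ⟨a, ha⟩ := Set.nonempty_of_ncard_ne_zero hr
    exact ⟨(r, a), ha, rfl⟩
  anti q r h := by
    refine Set.ncard_le_ncard ?_ (T.vecDom_finite q)
    intro a ha
    obtain ⟨x, hx⟩ := Option.ne_none_iff_exists'.mp ha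
    obtain ⟨y, hy, -⟩ := T.heap q r a x hx h
    simp [vecDom, hy]

/-- The nonempty cells of a heap tableau are determined by its shape. -/
theorem lt_shape_len_iff (T : HeapTableau k) (r : List (Fin k)) (a : ℕ) :
    a < T.shape.len r ↔ T.val (r, a) ≠ none := by
  have key : ∀ a, a ∈ T.vecDom r → ∀ b, b ≤ a → b ∈ T.vecDom r := by
    intro a ha b hb
    rcases hb.eq_or_lt with rfl | hb
    · exact ha
    · obtain ⟨x, hx⟩ := Option.ne_none_iff_exists'.mp ha
      obtain ⟨y, hy, -⟩ := T.vec r a b x hx hb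
      simp [vecDom, hy]
  constructor
  · intro h
    by_contra hn
    have hsub : T.vecDom r ⊆ Set.Iio a := by
      intro b hb
      by_contra hab
      exact key b hb a (by simpa using hab) (by simpa using hn)
    have h2 := Set.ncard_le_ncard hsub (Set.finite_Iio a)
    have h3 : (Set.Iio a).ncard = a := by
      rw [← Finset.coe_Iio, Set.ncard_coe_finset]; simp
    have h4 : T.shape.len r = (T.vecDom r).ncard := rfl
    omega
  · intro h
    have hsub : Set.Iio (a + 1) ⊆ T.vecDom r := by
      intro b hb
      exact key a h b (Nat.lt_succ_iff.mp hb)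
    have h2 := Set.ncard_le_ncard hsub (T.vecDom_finite r)
    have h3 : (Set.Iio (a + 1)).ncard = a + 1 := by
      rw [← Finset.coe_Iio, Set.ncard_coe_finset]; simp
    have h4 : T.shape.len r = (T.vecDom r).ncard := rfl
    omega

end HeapTableau

namespace Shape

variable {k : ℕ}

/-- The cells of a shape: all pairs `(r, a)` with `a < len r`. -/
noncomputable def cells (S : Shape k) : Finset (List (Fin k) × ℕ) :=
  S.finite_support.toFinset.biUnion fun r => (Finset.range (S.len r)).image (Prod.mk r)

theorem mem_cells (S : Shape k) (c : List (Fin k) × ℕ) : c ∈ S.cells ↔ c.2 < S.len c.1 := by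
  obtain ⟨r, a⟩ := c
  simp only [cells, Finset.mem_biUnion, Set.Finite.mem_toFinset, Set.mem_ofPred_eq,
    Finset.mem_image, Finset.mem_range, Prod.mk.injEq]
  constructor
  · rintro ⟨r', -, b, hb, rfl, rfl⟩
    exact hb
  · intro h
    exact ⟨r, by omega, a, h, rfl, rfl⟩

/-- The number of cells. -/
noncomputable def size (S : Shape k) : ℕ := S.cells.card

/-- The hook length of `(α, i)`: the number of cells `(β, j)` such that `j = i` and `α` is a
prefix of `β`, or `i ≤ j` and `β = α`. -/
noncomputable def hookLength (S : Shape k) (c : List (Fin k) × ℕ) : ℕ :=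
  (S.cells.filter fun d => (d.2 = c.2 ∧ c.1 <+: d.1) ∨ (c.2 ≤ d.2 ∧ c.1 = d.1)).card

/-- The number `n! / ∏ H` where `n` is the number of cells and the product of the hook lengths
is over all cells. -/
noncomputable def hookBound (S : Shape k) : ℚ :=
  ((S.size)! : ℚ) / ∏ c ∈ S.cells, (S.hookLength c : ℚ)

/-- The heap tableaux of shape `S` in which each of the numbers `1, …, n` occurs exactly once,
where `n` is the number of cells of `S`. -/
def fillings (S : Shape k) : Set (HeapTableau k) :=
  {T | T.shape = S ∧ ∀ i ∈ Finset.Icc 1 S.size, ∃! c, T.val c = some i}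

/-- The number of ways to fill the cells of `S` with `1, …, n` so as to get a heap tableau. -/
noncomputable def numFillings (S : Shape k) : ℕ := S.fillings.ncard

/-- The hook bound is tight for `S`. -/
def IsTight (S : Shape k) : Prop := (S.numFillings : ℚ) = S.hookBound

/-- The shapes of heap-ordered (`k`-ary) trees: each vector has at most one element. -/
def IsTreeShape (S : Shape k) : Prop := ∀ r, S.len r ≤ 1

/-- The Young diagram `μ` placed along the infinite branch `w`: the vector at the prefix of length
`j` of `w` is the `j`-th column of `μ`, and there are no other cells. -/
def ofYoung (w : ℕ → Fin k) (μ : YoungDiagram) : Shape k where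
  len r := if r = (List.range r.length).map w then μ.colLen r.length else 0
  finite_support := by
    refine ((Set.finite_Iio (μ.rowLen 0)).image fun n => (List.range n).map w).subset ?_
    intro r hr
    have hr' : (if r = (List.range r.length).map w then μ.colLen r.length else 0) ≠ 0 := hr
    split_ifs at hr' with h
    · refine ⟨r.length, ?_, h.symm⟩
      have h1 : (0, r.length) ∈ μ := YoungDiagram.mem_iff_lt_colLen.mpr (by omega)
      exact YoungDiagram.mem_iff_lt_rowLen.mp h1
    · exact absurd rfl hr'
  anti q r h := by
    have hlen := h.length_le
    by_cases hr : r = (List.range r.length).map w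
    · have hq : q = (List.range q.length).map w := by
        have h1 := List.prefix_iff_eq_take.mp h
        rw [hr, ← List.map_take, List.take_range, Nat.min_eq_left hlen] at h1
        exact h1
      rw [if_pos hr, if_pos hq]
      exact μ.colLen_anti _ _ hlen
    · rw [if_neg hr]
      exact Nat.zero_le _

/-- `S` is a Young diagram placed along some branch. -/
def IsYoungShape (S : Shape k) : Prop := ∃ (w : ℕ → Fin k) (μ : YoungDiagram), S = ofYoung w μ

/-- The shape `T_{r,k}`: the complete `k`-ary tree with levels `0, …, r - 1` as first heap, followed
by `k - 1` one-element heaps. -/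
def famT (r k : ℕ) : Shape k where
  len α := if α = [] then k else if α.length < r then 1 else 0
  finite_support := by
    refine ((List.finite_length_lt (Fin k) r).union (Set.finite_singleton [])).subset ?_
    intro α hα
    by_cases h0 : α = []
    · exact Or.inr h0
    · by_cases h1 : α.length < r
      · exact Or.inl h1
      · simp [h0, h1] at hα
  anti p q h := by
    have hlen := h.length_le
    by_cases hq : q = []
    · subst hq
      have hp : p = [] := List.prefix_nil.mp h
      simp [hp]
    · have hk : 0 < k := by
        obtain ⟨x, -⟩ := List.exists_mem_of_ne_nil q hq
        exact x.pos
      simp only [hq, if_false]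
      split_ifs <;> omega

/-- The shape `W_r` (for `2 ≤ r`): with `0`, `1` the first two letters, the first heap has
the addresses `λ, 0, 1, 11, …, 1^(2r-3)` and the second heap has the addresses `λ, 0`. -/
def famW {k : ℕ} (hk : 2 ≤ k) (r : ℕ) : Shape k where
  len α :=
    if α = [] ∨ α = [⟨0, by omega⟩] then 2
    else if α = List.replicate α.length ⟨1, by omega⟩ ∧ α.length + 3 ≤ 2 * r then 1 else 0
  finite_support := by
    refine ((List.finite_length_lt (Fin k) (2 * r)).union
      (Set.toFinite {[], [⟨0, by omega⟩]})).subset ?_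
    intro α hα
    by_cases h0 : α = [] ∨ α = [⟨0, by omega⟩]
    · exact Or.inr h0
    · by_cases h1 : α = List.replicate α.length ⟨1, by omega⟩ ∧ α.length + 3 ≤ 2 * r
      · refine Or.inl ?_
        have := h1.2
        change α.length < 2 * r
        omega
      · exact absurd (by rw [if_neg h0, if_neg h1]) hα
  anti p q h := by
    have hlen := h.length_le
    by_cases hp : p = [] ∨ p = [⟨0, by omega⟩]
    · rw [if_pos hp]
      split_ifs <;> omega
    · by_cases hq0 : q = [] ∨ q = [⟨0, by omega⟩]
      · exfalso
        apply hp
        rcases hq0 with hq0 | hq0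
        · rw [hq0] at h
          exact Or.inl (List.prefix_nil.mp h)
        · rw [hq0] at h
          rcases p with _ | ⟨a, t⟩
          · exact Or.inl rfl
          · rw [List.cons_prefix_cons] at h
            rw [List.prefix_nil.mp h.2, h.1]
            exact Or.inr rfl
      · by_cases hq : q = List.replicate q.length ⟨1, by omega⟩ ∧ q.length + 3 ≤ 2 * r
        · have hp1 : p = List.replicate p.length ⟨1, by omega⟩ := by
            have h1 := List.prefix_iff_eq_take.mp h
            rw [hq.1, List.take_replicate, Nat.min_eq_left hlen] at h1
            exact h1
          have := hq.2
          rw [if_neg hp, if_neg hq0, if_pos hq, if_pos ⟨hp1, by omega⟩]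
        · rw [if_neg hq0, if_neg hq]
          exact Nat.zero_le _

end Shape

end HeapTableaux

/-! The largest entry of a filling sits at a corner, so N(S) is the sum of N(S - c) over the corners
c, and by induction the bound follows from F(S) ≤ ∑ F(S - c) (`hookBound_le_sum`). Deleting c
shortens by one exactly the hooks of other cells that contain c. Hence n F(S - c) / F(S) is a
product of factors 1 + 1/(H - 1) over the cells before c in its heap and in its vector. Expanding
the product gives a sum over the cells d of path weights W_c(d), as in the hook walk of Greene,
Nijenhuis and Wilf (`IsCorner.hookBound_truncate`). It remains to show that ∑_c W_c(d) ≥ 1 for each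
cell d (`one_le_totalWeight`).

The sum of W_c over the hook of d without d is (h' + h'') W_c(d), where h' and h'' are the excesses
H - 1 of the projections of d to the heap and to the address of c. For Young diagrams h' + h'' is
the excess of d. Here the arm of d contains the disjoint union of the two projected arms, possibly
properly, so only ≤ remains (`arm_union_subset`, `IsCorner.excess_sub`); induction from the corners
to the root then yields ≥ 1. The bound is tight if the inclusion is an equality throughout a class
closed under deletion of corners (`isTight_of_closed`), and a single proper inclusion in S destroys
tightness (`not_isTight_of_not_armsSplit`). -/

namespace HeapTableaux

open Finset

/-! ### Weighted paths on a line -/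

/-- The product of the factors `1 + 1 / h m` for `l ≤ m < p`. -/
def tailProd (h : ℕ → ℚ) (p l : ℕ) : ℚ := ∏ m ∈ Ico l p, (1 + 1 / h m)

/-- The total weight of the increasing paths from `l` to `p`, where each vertex `m < p` of the path
contributes a factor `1 / h m`. -/
def pathWeight (h : ℕ → ℚ) (p l : ℕ) : ℚ := if l = p then 1 else tailProd h p (l + 1) / h l

/-- Expanding the product chooses which vertices the path visits; the smallest chosen one is its
start. -/
theorem sum_Icc_pathWeight (h : ℕ → ℚ) {p l : ℕ} (hl : l ≤ p) :
    ∑ m ∈ Icc l p, pathWeight h p m = tailProd h p l := by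
  induction hl using Nat.decreasingInduction with
  | self => simp [pathWeight, tailProd]
  | of_succ l hl ih =>
    rw [← Finset.insert_Icc_add_one_left_eq_Icc (by omega), sum_insert (by simp), ih, tailProd,
      tailProd, prod_eq_prod_Ico_succ_bot hl, pathWeight, if_neg (by omega), tailProd]
    ring

/-- This is the decomposition of a path by its first step. At `l = p` the sum is empty, and `h p =
0` makes the right side vanish. -/
theorem sum_Ioc_pathWeight {h : ℕ → ℚ} {p l : ℕ} (hl : l ≤ p) (hp : h p = 0)
    (hpos : ∀ m < p, 0 < h m) : ∑ m ∈ Ioc l p, pathWeight h p m = h l * pathWeight h p l := by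
  rcases hl.eq_or_lt with rfl | hl
  · simp [hp]
  · rw [← Finset.Icc_add_one_left_eq_Ioc, sum_Icc_pathWeight h (by omega), pathWeight,
      if_neg (by omega), mul_div_cancel₀ _ (hpos l hl).ne']

theorem pathWeight_pos {h : ℕ → ℚ} {p l : ℕ} (hl : l ≤ p) (hpos : ∀ m < p, 0 < h m) :
    0 < pathWeight h p l := by
  rw [pathWeight]
  split_ifs with hlp
  · exact one_pos
  · refine div_pos (prod_pos fun m hm => ?_) (hpos l (by omega))
    have := hpos m (mem_Ico.mp hm).2
    positivity

namespace Shape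

variable {k : ℕ}

/-! ### Corners, deletion of corners, and hooks -/

/-- A corner: a cell that no other cell depends on. -/
def IsCorner (S : Shape k) (c : List (Fin k) × ℕ) : Prop :=
  S.len c.1 = c.2 + 1 ∧ ∀ r, c.1 <+: r → r ≠ c.1 → S.len r ≤ c.2

open Classical in
/-- The corners of a shape. -/
noncomputable def corners (S : Shape k) : Finset (List (Fin k) × ℕ) := S.cells.filter S.IsCorner

theorem IsCorner.mem_cells {S : Shape k} {c} (hc : S.IsCorner c) : c ∈ S.cells := by
  rw [S.mem_cells, hc.1]
  omega

theorem mem_corners {S : Shape k} {c} : c ∈ S.corners ↔ S.IsCorner c := by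
  simp only [corners, mem_filter, and_iff_right_iff_imp]
  exact IsCorner.mem_cells

/-- The shape without the cells `(r, a)` with `c.1 <+: r` and `c.2 ≤ a`. -/
def truncate (S : Shape k) (c : List (Fin k) × ℕ) : Shape k where
  len r := if c.1 <+: r then min (S.len r) c.2 else S.len r
  finite_support := by
    refine S.finite_support.subset fun r hr h0 => hr ?_
    simp [h0]
  anti q r h := by
    have := S.anti q r h
    by_cases hq : c.1 <+: q
    · simp only [hq, hq.trans h, if_true]
      omega
    · simp only [hq, if_false]
      split_ifs <;> omega

theorem truncate_len_le (S : Shape k) (c) (r) : (S.truncate c).len r ≤ S.len r := by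
  simp only [truncate]
  split_ifs <;> omega

/-- `truncate` makes sense for any cell; being a corner is what reduces the loss to one cell. -/
theorem IsCorner.cells_truncate {S : Shape k} {c} (hc : S.IsCorner c) :
    (S.truncate c).cells = S.cells.erase c := by
  ext ⟨r, a⟩
  obtain ⟨α, i⟩ := c
  have h1 := hc.1
  have h2 := hc.2 r
  simp only [Shape.mem_cells, truncate, mem_erase, ne_eq, Prod.mk.injEq, not_and] at *
  by_cases hr : r = α
  · subst hr
    simp [h1]
    omega
  · simp only [hr, false_implies, true_and]
    split_ifs with hp
    · have := h2 hp hr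
      omega
    · rfl

theorem IsCorner.size_truncate {S : Shape k} {c} (hc : S.IsCorner c) :
    (S.truncate c).size + 1 = S.size := by
  rw [size, hc.cells_truncate, card_erase_add_one hc.mem_cells, size]

/-- The cells of the same heap that lie strictly below `c`. -/
noncomputable def armSet (S : Shape k) (c : List (Fin k) × ℕ) : Finset (List (Fin k) × ℕ) :=
  S.cells.filter fun d => d.2 = c.2 ∧ c.1 <+: d.1 ∧ d.1 ≠ c.1

/-- The cells of the hook of `c`. -/
noncomputable def hook (S : Shape k) (c : List (Fin k) × ℕ) : Finset (List (Fin k) × ℕ) :=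
  S.cells.filter fun d => (d.2 = c.2 ∧ c.1 <+: d.1) ∨ (c.2 ≤ d.2 ∧ c.1 = d.1)

theorem self_mem_hook {S : Shape k} {c} (hc : c ∈ S.cells) : c ∈ S.hook c := by
  simp [hook, hc]

theorem hookLength_eq_card (S : Shape k) (c) : S.hookLength c = (S.hook c).card := rfl

/-- The leg is indexed from `c.2`, so the cell itself is counted there and not in the arm. -/
theorem sum_hook (S : Shape k) (c) (f : List (Fin k) × ℕ → ℚ) :
    ∑ d ∈ S.hook c, f d = ∑ d ∈ S.armSet c, f d + ∑ j ∈ Ico c.2 (S.len c.1), f (c.1, j) := by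
  have h : S.hook c = S.armSet c ∪ (Ico c.2 (S.len c.1)).image (Prod.mk c.1) := by
    ext ⟨r, a⟩
    obtain ⟨α, i⟩ := c
    simp only [hook, armSet, mem_union, mem_filter, Shape.mem_cells, mem_image, mem_Ico,
      Prod.mk.injEq]
    constructor
    · rintro ⟨h1, ⟨rfl, h2⟩ | ⟨h2, rfl⟩⟩
      · by_cases hr : r = α
        · subst hr
          exact Or.inr ⟨a, ⟨le_rfl, h1⟩, rfl, rfl⟩
        · exact Or.inl ⟨h1, rfl, h2, hr⟩
      · exact Or.inr ⟨a, ⟨h2, h1⟩, rfl, rfl⟩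
    · rintro (⟨h1, rfl, h2, -⟩ | ⟨b, ⟨h1, h2⟩, rfl, rfl⟩)
      · exact ⟨h1, Or.inl ⟨rfl, h2⟩⟩
      · exact ⟨h2, Or.inr ⟨h1, rfl⟩⟩
  rw [h, sum_union, sum_image]
  · intro a _ b _ hab
    exact (Prod.mk.inj hab).2
  · rw [disjoint_left]
    intro d hd hd'
    obtain ⟨b, -, rfl⟩ := mem_image.mp hd'
    exact (mem_filter.mp hd).2.2.2 rfl

/-- The hook length minus one, as a rational number. -/
noncomputable def excess (S : Shape k) (c : List (Fin k) × ℕ) : ℚ := (S.hookLength c : ℚ) - 1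

theorem excess_eq {S : Shape k} {c} (hc : c ∈ S.cells) :
    S.excess c = ((S.armSet c).card : ℚ) + ((S.len c.1 : ℚ) - c.2 - 1) := by
  have h := S.sum_hook c fun _ => 1
  have hc' := (S.mem_cells c).mp hc
  simp only [sum_const, nsmul_eq_mul, mul_one, Nat.card_Ico] at h
  rw [excess, hookLength_eq_card, h, Nat.cast_sub hc'.le]
  ring

theorem excess_nonneg {S : Shape k} {c} (hc : c ∈ S.cells) : 0 ≤ S.excess c := by
  have : 1 ≤ S.hookLength c := card_pos.mpr ⟨c, self_mem_hook hc⟩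
  rw [excess, sub_nonneg]
  exact_mod_cast this

theorem excess_pos {S : Shape k} {c d} (hc : c ∈ S.cells) (hd : d ∈ S.hook c) (h : d ≠ c) :
    0 < S.excess c := by
  have : 1 < S.hookLength c := one_lt_card.mpr ⟨d, hd, c, self_mem_hook hc, h⟩
  rw [excess, sub_pos]
  exact_mod_cast this

theorem IsCorner.hook_eq {S : Shape k} {c} (hc : S.IsCorner c) : S.hook c = {c} := by
  refine eq_singleton_iff_unique_mem.mpr ⟨self_mem_hook hc.mem_cells, ?_⟩
  rintro ⟨r, a⟩ hd
  obtain ⟨α, i⟩ := c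
  simp only [hook, mem_filter, Shape.mem_cells] at hd
  obtain ⟨h1, ⟨rfl, h2⟩ | ⟨h2, rfl⟩⟩ := hd
  · by_contra hne
    have := hc.2 r h2 fun h => hne (Prod.ext h rfl)
    simp only at this
    omega
  · have := hc.1
    simp only at this
    rw [show a = i by omega]

theorem IsCorner.hookLength {S : Shape k} {c} (hc : S.IsCorner c) : S.hookLength c = 1 := by
  rw [hookLength_eq_card, hc.hook_eq, card_singleton]

theorem IsCorner.excess {S : Shape k} {c} (hc : S.IsCorner c) : S.excess c = 0 := by
  rw [Shape.excess, hc.hookLength]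
  simp

theorem exists_mem_hook_of_not_isCorner {S : Shape k} {c} (hc : c ∈ S.cells)
    (h : ¬ S.IsCorner c) : ∃ d ∈ S.hook c, d ≠ c := by
  rw [IsCorner, not_and_or] at h
  rw [Shape.mem_cells] at hc
  rcases h with h | h
  · refine ⟨(c.1, c.2 + 1), ?_, fun h => by simpa using congrArg Prod.snd h⟩
    simp only [hook, mem_filter, Shape.mem_cells]
    exact ⟨by omega, Or.inr ⟨by omega, trivial⟩⟩
  · push Not at h
    obtain ⟨r, h1, h2, h3⟩ := h
    refine ⟨(r, c.2), ?_, fun h => h2 (congrArg Prod.fst h)⟩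
    simp only [hook, mem_filter, Shape.mem_cells]
    exact ⟨h3, Or.inl ⟨trivial, h1⟩⟩

/-! ### Weights directed at a corner -/

/-- The weight of the cell `d` in the hook walk to the corner `c`. -/
noncomputable def walkWeight (S : Shape k) (c d : List (Fin k) × ℕ) : ℚ :=
  if d.1 <+: c.1 ∧ d.2 ≤ c.2 then
    pathWeight (fun l => S.excess (c.1.take l, c.2)) c.1.length d.1.length *
      pathWeight (fun j => S.excess (c.1, j)) c.2 d.2
  else 0

theorem mem_cells_of_le {S : Shape k} {c d : List (Fin k) × ℕ} (hc : c ∈ S.cells)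
    (h1 : d.1 <+: c.1) (h2 : d.2 ≤ c.2) : d ∈ S.cells := by
  have := S.anti _ _ h1
  rw [Shape.mem_cells] at *
  omega

theorem excess_take_pos {S : Shape k} {c} (hc : c ∈ S.cells) (l : ℕ) (hl : l < c.1.length) :
    0 < S.excess (c.1.take l, c.2) := by
  refine excess_pos (d := c) (mem_cells_of_le hc (List.take_prefix _ _) le_rfl) ?_ ?_
  · simp only [hook, mem_filter]
    exact ⟨hc, Or.inl ⟨trivial, List.take_prefix _ _⟩⟩
  · intro h
    have := congrArg (fun d => d.1.length) h
    simp at this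
    omega

theorem excess_col_pos {S : Shape k} {c} (hc : c ∈ S.cells) (j : ℕ) (hj : j < c.2) :
    0 < S.excess (c.1, j) := by
  refine excess_pos (d := c) (mem_cells_of_le hc List.prefix_rfl hj.le) ?_ ?_
  · simp only [hook, mem_filter]
    exact ⟨hc, Or.inr ⟨hj.le, trivial⟩⟩
  · intro h
    exact hj.ne (congrArg Prod.snd h).symm

theorem walkWeight_pos {S : Shape k} {c d} (hc : c ∈ S.cells) (h1 : d.1 <+: c.1)
    (h2 : d.2 ≤ c.2) : 0 < S.walkWeight c d := by
  rw [walkWeight, if_pos ⟨h1, h2⟩]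
  exact mul_pos (pathWeight_pos h1.length_le (excess_take_pos hc))
    (pathWeight_pos h2 (excess_col_pos hc))

theorem walkWeight_nonneg {S : Shape k} {c} (hc : c ∈ S.cells) (d) : 0 ≤ S.walkWeight c d := by
  by_cases h : d.1 <+: c.1 ∧ d.2 ≤ c.2
  · exact (walkWeight_pos hc h.1 h.2).le
  · rw [walkWeight, if_neg h]

theorem walkWeight_self (S : Shape k) (c) : S.walkWeight c c = 1 := by
  simp [walkWeight, pathWeight]

/-- A nonzero weight needs `d` to precede `c` in both coordinates, and only `d` itself lies beyond a
corner `d`. -/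
theorem IsCorner.walkWeight_of_ne {S : Shape k} {c d} (hd : S.IsCorner d) (hc : c ∈ S.cells)
    (h : c ≠ d) : S.walkWeight c d = 0 := by
  rw [walkWeight, if_neg]
  rintro ⟨h1, h2⟩
  rw [Shape.mem_cells] at hc
  have h3 := hd.1
  by_cases h4 : c.1 = d.1
  · rw [h4] at hc
    exact h (Prod.ext h4 (by omega))
  · have := hd.2 _ h1 h4
    omega

/-! ### Comparison of arms and summation over hooks -/

theorem arm_union_subset {S : Shape k} {c d : List (Fin k) × ℕ}
    (h1 : d.1 <+: c.1) (h2 : d.2 ≤ c.2) :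
    (S.armSet (d.1, c.2)).image (fun e => (e.1, d.2)) ∪ S.armSet (c.1, d.2) ⊆ S.armSet d := by
  intro e he
  rw [mem_union, mem_image] at he
  rcases he with ⟨e', he', rfl⟩ | he
  · simp only [armSet, mem_filter, Shape.mem_cells] at he' ⊢
    exact ⟨by omega, trivial, he'.2.2⟩
  · simp only [armSet, mem_filter, Shape.mem_cells] at he ⊢
    refine ⟨he.1, he.2.1, h1.trans he.2.2.1, fun h => he.2.2.2 ?_⟩
    rw [h] at he ⊢
    exact h1.eq_of_length (le_antisymm h1.length_le he.2.2.1.length_le)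

/-- A common element would be an address strictly below `c.1` still carrying index `c.2`, which a
corner forbids. -/
theorem IsCorner.card_arm_union {S : Shape k} {c d : List (Fin k) × ℕ} (hc : S.IsCorner c) :
    ((S.armSet (d.1, c.2)).image (fun e => (e.1, d.2)) ∪ S.armSet (c.1, d.2)).card =
      (S.armSet (d.1, c.2)).card + (S.armSet (c.1, d.2)).card := by
  rw [card_union_of_disjoint, card_image_of_injOn]
  · intro e he e' he' h
    simp only [armSet, coe_filter, Set.mem_ofPred_eq] at he he'
    exact Prod.ext (Prod.mk.inj h).1 (he.2.1.trans he'.2.1.symm)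
  · rw [disjoint_left]
    intro e he he'
    obtain ⟨e, h, rfl⟩ := mem_image.mp he
    simp only [armSet, mem_filter, Shape.mem_cells] at h he'
    have := hc.2 _ he'.2.2.1 he'.2.2.2
    omega

/-- The legs contribute nothing: they add up exactly because `S.len c.1 = c.2 + 1`. Only the arms
can differ. -/
theorem IsCorner.excess_sub {S : Shape k} {c d : List (Fin k) × ℕ} (hc : S.IsCorner c)
    (h1 : d.1 <+: c.1) (h2 : d.2 ≤ c.2) :
    S.excess d - (S.excess (d.1, c.2) + S.excess (c.1, d.2)) =
      (S.armSet d).card - ((S.armSet (d.1, c.2)).image (fun e => (e.1, d.2)) ∪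
        S.armSet (c.1, d.2)).card := by
  rw [excess_eq (mem_cells_of_le hc.mem_cells h1 h2),
    excess_eq (mem_cells_of_le (d := (d.1, c.2)) hc.mem_cells h1 le_rfl),
    excess_eq (mem_cells_of_le (d := (c.1, d.2)) hc.mem_cells List.prefix_rfl h2),
    hc.card_arm_union, hc.1]
  push_cast
  ring

/-- Only prefixes of `c.1` carry weight, so the sum over the tree is a sum along one branch, to
which the first-step identity applies. -/
theorem sum_armSet_walkWeight {S : Shape k} {c d : List (Fin k) × ℕ} (hc : S.IsCorner c)
    (h1 : d.1 <+: c.1) (h2 : d.2 ≤ c.2) :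
    ∑ e ∈ S.armSet d, S.walkWeight c e = S.excess (d.1, c.2) * S.walkWeight c d := by
  -- The branch ends at `c` itself, whose excess is 0.
  have hsum := sum_Ioc_pathWeight (h := fun l => S.excess (c.1.take l, c.2)) h1.length_le
    (by simpa using hc.excess) (excess_take_pos hc.mem_cells)
  simp only [← List.prefix_iff_eq_take.mp h1] at hsum
  rw [walkWeight, if_pos ⟨h1, h2⟩, ← mul_assoc, ← hsum, sum_mul]
  symm
  refine sum_of_injOn (fun l => (c.1.take l, d.2)) ?_ ?_ ?_ ?_
  · intro l hl l' hl' h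
    simp only [coe_Ioc, Set.mem_Ioc] at hl hl'
    have := congrArg (fun d => d.1.length) h
    simp only [List.length_take] at this
    omega
  · intro l hl
    simp only [coe_Ioc, Set.mem_Ioc] at hl
    simp only [armSet, coe_filter, Set.mem_ofPred_eq]
    refine ⟨mem_cells_of_le hc.mem_cells (List.take_prefix _ _) h2, trivial, ?_, fun h => ?_⟩
    · rw [List.prefix_iff_eq_take.mp h1]
      exact List.take_prefix_take_left hl.1.le
    · have := congrArg List.length h
      simp only [List.length_take] at this
      omega
  · intro e he hne
    rw [walkWeight, if_neg]
    rintro ⟨h3, h4⟩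
    simp only [armSet, mem_filter] at he
    refine hne ⟨e.1.length, ?_, Prod.ext (List.prefix_iff_eq_take.mp h3).symm he.2.1.symm⟩
    simp only [coe_Ioc, Set.mem_Ioc]
    refine ⟨lt_of_le_of_ne he.2.2.1.length_le fun h => he.2.2.2 ?_, h3.length_le⟩
    exact (he.2.2.1.eq_of_length h).symm
  · intro l hl
    rw [mem_Ioc] at hl
    rw [walkWeight, if_pos ⟨List.take_prefix _ _, h2⟩, List.length_take, Nat.min_eq_left hl.2]

theorem sum_leg_walkWeight {S : Shape k} {c d : List (Fin k) × ℕ} (hc : S.IsCorner c)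
    (h1 : d.1 <+: c.1) (h2 : d.2 ≤ c.2) :
    ∑ j ∈ Ico d.2 (S.len d.1), S.walkWeight c (d.1, j) =
      S.walkWeight c d + S.excess (c.1, d.2) * S.walkWeight c d := by
  have hsum := sum_Ioc_pathWeight (h := fun j => S.excess (c.1, j)) h2
    hc.excess (excess_col_pos hc.mem_cells)
  have hsub : Icc d.2 c.2 ⊆ Ico d.2 (S.len d.1) := by
    have := S.anti _ _ h1
    have := hc.1
    intro j hj
    simp only [mem_Icc, mem_Ico] at *
    omega
  rw [← sum_subset hsub, ← Finset.Ioc_insert_left h2, sum_insert (by simp)]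
  · congr 1
    have hw : S.walkWeight c d = _ := if_pos ⟨h1, h2⟩
    rw [hw, mul_left_comm, ← hsum, mul_sum]
    refine sum_congr rfl fun j hj => ?_
    rw [walkWeight, if_pos ⟨h1, (mem_Ioc.mp hj).2⟩]
  · intro j hj hj'
    rw [walkWeight, if_neg]
    rintro ⟨-, h⟩
    exact hj' (mem_Icc.mpr ⟨(mem_Ico.mp hj).1, h⟩)

/-- The key identity: the two factors of the weight vary separately along arm and leg, and the 1
accounts for `d` itself. -/
theorem sum_hook_walkWeight {S : Shape k} {c d : List (Fin k) × ℕ} (hc : S.IsCorner c)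
    (h1 : d.1 <+: c.1) (h2 : d.2 ≤ c.2) :
    ∑ e ∈ S.hook d, S.walkWeight c e =
      (1 + S.excess (d.1, c.2) + S.excess (c.1, d.2)) * S.walkWeight c d := by
  rw [sum_hook, sum_armSet_walkWeight hc h1 h2, sum_leg_walkWeight hc h1 h2]
  ring

/-- Hooks only move away from the root, so they never return to a cell that precedes `c`. -/
theorem sum_hook_walkWeight_of_not (S : Shape k) {c d : List (Fin k) × ℕ}
    (h : ¬ (d.1 <+: c.1 ∧ d.2 ≤ c.2)) : ∑ e ∈ S.hook d, S.walkWeight c e = 0 := by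
  refine sum_eq_zero fun e he => ?_
  rw [walkWeight, if_neg]
  rintro ⟨h3, h4⟩
  simp only [hook, mem_filter] at he
  obtain ⟨-, ⟨h5, h6⟩ | ⟨h5, h6⟩⟩ := he
  · exact h ⟨h6.trans h3, h5 ▸ h4⟩
  · exact h ⟨h6 ▸ h3, h5.trans h4⟩

theorem sum_hook_walkWeight_le {S : Shape k} {c : List (Fin k) × ℕ} (hc : S.IsCorner c) (d) :
    ∑ e ∈ S.hook d, S.walkWeight c e ≤ (1 + S.excess d) * S.walkWeight c d := by
  by_cases h : d.1 <+: c.1 ∧ d.2 ≤ c.2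
  · rw [sum_hook_walkWeight hc h.1 h.2]
    have h1 := hc.excess_sub h.1 h.2
    have h2 : (_ : ℚ) ≤ _ := Nat.cast_le.mpr (card_le_card (arm_union_subset (S := S) h.1 h.2))
    exact mul_le_mul_of_nonneg_right (by linarith) (walkWeight_nonneg hc.mem_cells d)
  · rw [S.sum_hook_walkWeight_of_not h, walkWeight, if_neg h, mul_zero]

/-- The cells below the corner `c` have arms that satisfy the relation known from Young diagrams. -/
def ArmsSplit (S : Shape k) (c d : List (Fin k) × ℕ) : Prop :=
  S.armSet d ⊆ (S.armSet (d.1, c.2)).image (fun e => (e.1, d.2)) ∪ S.armSet (c.1, d.2)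

theorem sum_hook_walkWeight_eq {S : Shape k} {c : List (Fin k) × ℕ} (hc : S.IsCorner c) (d)
    (hs : d.1 <+: c.1 → d.2 ≤ c.2 → S.ArmsSplit c d) :
    ∑ e ∈ S.hook d, S.walkWeight c e = (1 + S.excess d) * S.walkWeight c d := by
  by_cases h : d.1 <+: c.1 ∧ d.2 ≤ c.2
  · rw [sum_hook_walkWeight hc h.1 h.2]
    have h1 := hc.excess_sub h.1 h.2
    rw [← (hs h.1 h.2).antisymm (arm_union_subset h.1 h.2), sub_self] at h1
    rw [add_assoc, ← sub_eq_zero.mp h1]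
  · rw [S.sum_hook_walkWeight_of_not h, walkWeight, if_neg h, mul_zero]

theorem sum_hook_walkWeight_lt {S : Shape k} {c : List (Fin k) × ℕ} (hc : S.IsCorner c) {d}
    (h1 : d.1 <+: c.1) (h2 : d.2 ≤ c.2) (hs : ¬ S.ArmsSplit c d) :
    ∑ e ∈ S.hook d, S.walkWeight c e < (1 + S.excess d) * S.walkWeight c d := by
  rw [sum_hook_walkWeight hc h1 h2]
  have h3 := hc.excess_sub h1 h2
  have h4 : (_ : ℚ) < _ := Nat.cast_lt.mpr
    (card_lt_card (ssubset_iff_subset_not_subset.mpr ⟨arm_union_subset (S := S) h1 h2, hs⟩))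
  exact mul_lt_mul_of_pos_right (by linarith) (walkWeight_pos hc.mem_cells h1 h2)

/-! ### The total weight is at least one -/

/-- The sum of the weights of a cell over all corners. -/
noncomputable def totalWeight (S : Shape k) (d : List (Fin k) × ℕ) : ℚ :=
  ∑ c ∈ S.corners, S.walkWeight c d

/-- Induction on the cells, from the corners to the root. -/
theorem cell_induction {S : Shape k} {P : List (Fin k) × ℕ → Prop}
    (h : ∀ d ∈ S.cells, (∀ e ∈ S.hook d, e ≠ d → P e) → P d) : ∀ d ∈ S.cells, P d := by
  classical
  by_contra! hcon
  obtain ⟨d, hd, hP⟩ := hcon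
  -- Depth plus index strictly grows from a cell to the others of its hook, so a counterexample
  -- maximizing it is terminal.
  obtain ⟨d, hd, hmax⟩ := (S.cells.filter fun d => ¬ P d).exists_max_image
    (fun d => d.1.length + d.2) ⟨d, mem_filter.mpr ⟨hd, hP⟩⟩
  rw [mem_filter] at hd
  refine hd.2 (h d hd.1 fun e he hne => ?_)
  by_contra hPe
  simp only [hook, mem_filter] at he
  have h1 := hmax e (mem_filter.mpr ⟨he.1, hPe⟩)
  obtain ⟨-, ⟨h5, h6⟩ | ⟨h5, h6⟩⟩ := he
  · have := h6.length_le
    exact hne (Prod.ext (h6.eq_of_length (by omega)).symm h5)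
  · rw [h6] at h1
    exact hne (Prod.ext h6.symm (by omega))

theorem sum_hook_totalWeight_le (S : Shape k) (d) :
    ∑ e ∈ S.hook d, S.totalWeight e ≤ (1 + S.excess d) * S.totalWeight d := by
  simp only [totalWeight]
  rw [sum_comm, mul_sum]
  exact sum_le_sum fun c hc => sum_hook_walkWeight_le (mem_corners.mp hc) d

theorem sum_hook_erase_totalWeight_ge {S : Shape k} {d} (hd : d ∈ S.cells)
    (ih : ∀ e ∈ S.hook d, e ≠ d → 1 ≤ S.totalWeight e) :
    S.excess d + S.totalWeight d ≤ ∑ e ∈ S.hook d, S.totalWeight e := by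
  rw [← sum_erase_add _ _ (self_mem_hook hd), add_le_add_iff_right]
  have : ∑ e ∈ (S.hook d).erase d, (1 : ℚ) = S.excess d := by
    rw [sum_const, card_erase_of_mem (self_mem_hook hd), nsmul_eq_mul, mul_one, excess,
      hookLength_eq_card, Nat.cast_pred (card_pos.mpr ⟨d, self_mem_hook hd⟩)]
  rw [← this]
  exact sum_le_sum fun e he => ih e (mem_of_mem_erase he) (ne_of_mem_erase he)

theorem IsCorner.totalWeight {S : Shape k} {d} (hd : S.IsCorner d) : S.totalWeight d = 1 := by
  rw [Shape.totalWeight, sum_eq_single_of_mem d (mem_corners.mpr hd), walkWeight_self]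
  exact fun c hc hne => hd.walkWeight_of_ne (mem_corners.mp hc).mem_cells hne

/-- Off the corners, the hook sums give `excess d ≤ excess d * totalWeight d` by induction, and the
positive excess cancels. -/
theorem one_le_totalWeight (S : Shape k) : ∀ d ∈ S.cells, 1 ≤ S.totalWeight d := by
  refine cell_induction fun d hd ih => ?_
  by_cases hc : S.IsCorner d
  · exact hc.totalWeight.ge
  · obtain ⟨e, he, hne⟩ := exists_mem_hook_of_not_isCorner hd hc
    have h1 := (sum_hook_erase_totalWeight_ge hd ih).trans (S.sum_hook_totalWeight_le d)
    have h2 := excess_pos hd he hne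
    exact le_of_mul_le_mul_left (by linarith) h2

theorem totalWeight_eq_one {S : Shape k} (hS : ∀ c, S.IsCorner c → ∀ d : List (Fin k) × ℕ,
    d.1 <+: c.1 → d.2 ≤ c.2 → S.ArmsSplit c d) : ∀ d ∈ S.cells, S.totalWeight d = 1 := by
  refine cell_induction fun d hd ih => ?_
  by_cases hc : S.IsCorner d
  · exact hc.totalWeight
  · obtain ⟨e, he, hne⟩ := exists_mem_hook_of_not_isCorner hd hc
    have h2 := excess_pos hd he hne
    have h1 : ∑ e ∈ S.hook d, S.totalWeight e = (1 + S.excess d) * S.totalWeight d := by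
      simp only [totalWeight]
      rw [sum_comm, mul_sum]
      exact sum_congr rfl fun c hc =>
        sum_hook_walkWeight_eq (mem_corners.mp hc) d (hS c (mem_corners.mp hc) d)
    rw [← sum_erase_add _ _ (self_mem_hook hd), sum_congr rfl fun e he =>
      ih e (mem_of_mem_erase he) (ne_of_mem_erase he), sum_const,
      card_erase_of_mem (self_mem_hook hd), nsmul_eq_mul, mul_one,
      Nat.cast_pred (card_pos.mpr ⟨d, self_mem_hook hd⟩), ← hookLength_eq_card, ← excess] at h1
    exact mul_left_cancel₀ h2.ne' (by linarith)

/-- One strict inequality among the corners suffices, since all other cells of the hook are already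
known to have total weight at least 1. -/
theorem one_lt_totalWeight {S : Shape k} {c d} (hc : S.IsCorner c)
    (h1 : d.1 <+: c.1) (h2 : d.2 ≤ c.2) (hs : ¬ S.ArmsSplit c d) : 1 < S.totalWeight d := by
  have hd := mem_cells_of_le hc.mem_cells h1 h2
  have h3 := sum_hook_erase_totalWeight_ge hd fun e he _ =>
    S.one_le_totalWeight e (mem_filter.mp he).1
  have h4 : ∑ e ∈ S.hook d, S.totalWeight e < (1 + S.excess d) * S.totalWeight d := by
    simp only [totalWeight]
    rw [sum_comm, mul_sum]
    exact sum_lt_sum (fun c hc => sum_hook_walkWeight_le (mem_corners.mp hc) d)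
      ⟨c, mem_corners.mpr hc, sum_hook_walkWeight_lt hc h1 h2 hs⟩
  exact lt_of_mul_lt_mul_left (by linarith) (excess_nonneg hd)

/-! ### Change of the hook bound when a corner is deleted -/

theorem sum_cells_walkWeight {S : Shape k} {c} (hc : S.IsCorner c) :
    ∑ d ∈ S.cells, S.walkWeight c d =
      tailProd (fun l => S.excess (c.1.take l, c.2)) c.1.length 0 *
        tailProd (fun j => S.excess (c.1, j)) c.2 0 := by
  -- The cells of nonzero weight form a grid: prefixes of `c.1` times indices up to `c.2`.
  rw [← sum_Icc_pathWeight _ (Nat.zero_le _), ← sum_Icc_pathWeight _ (Nat.zero_le _),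
    sum_mul_sum, ← sum_product']
  symm
  refine sum_of_injOn (fun x => (c.1.take x.1, x.2)) ?_ ?_ ?_ ?_
  · rintro ⟨l, j⟩ hl ⟨l', j'⟩ hl' h
    simp only [coe_product, Set.mem_prod, coe_Icc, Set.mem_Icc] at hl hl'
    have h1 := congrArg (fun d => d.1.length) h
    have h2 := congrArg Prod.snd h
    simp only [List.length_take] at h1 h2
    exact Prod.ext (by simp only; omega) h2
  · rintro ⟨l, j⟩ hl
    simp only [coe_product, Set.mem_prod, coe_Icc, Set.mem_Icc] at hl
    exact mem_cells_of_le hc.mem_cells (List.take_prefix _ _) hl.2.2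
  · intro e he hne
    rw [walkWeight, if_neg]
    rintro ⟨h3, h4⟩
    refine hne ⟨(e.1.length, e.2), ?_, Prod.ext (List.prefix_iff_eq_take.mp h3).symm rfl⟩
    simp only [coe_product, Set.mem_prod, coe_Icc, Set.mem_Icc]
    exact ⟨⟨Nat.zero_le _, h3.length_le⟩, Nat.zero_le _, h4⟩
  · rintro ⟨l, j⟩ hl
    simp only [mem_product, mem_Icc] at hl
    rw [walkWeight, if_pos ⟨List.take_prefix _ _, hl.2.2⟩, List.length_take,
      Nat.min_eq_left hl.1.2]

theorem IsCorner.hookLength_truncate {S : Shape k} {c} (hc : S.IsCorner c) (d) :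
    (S.truncate c).hookLength d = if c ∈ S.hook d then S.hookLength d - 1 else S.hookLength d := by
  have h : (S.truncate c).hook d = (S.hook d).erase c := by
    rw [hook, hc.cells_truncate, filter_erase, ← hook]
  rw [hookLength_eq_card, h]
  split_ifs with hcd
  · rw [card_erase_of_mem hcd, hookLength_eq_card]
  · rw [erase_eq_of_notMem hcd, hookLength_eq_card]

/-- Apart from `c`, the hooks through `c` start at a proper prefix in the same heap or at a smaller
index in the same vector. -/
theorem IsCorner.prod_hook {S : Shape k} {c} (hc : S.IsCorner c) :
    ∏ d ∈ S.cells.erase c, (if c ∈ S.hook d then 1 + 1 / S.excess d else 1) =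
      tailProd (fun l => S.excess (c.1.take l, c.2)) c.1.length 0 *
        tailProd (fun j => S.excess (c.1, j)) c.2 0 := by
  rw [← prod_filter, tailProd, tailProd]
  have h : (S.cells.erase c).filter (fun d => c ∈ S.hook d) =
      (Ico 0 c.1.length).image (fun l => (c.1.take l, c.2)) ∪
        (Ico 0 c.2).image (fun j => (c.1, j)) := by
    ext d
    simp only [mem_filter, mem_erase, mem_union, mem_image, mem_Ico, hook, Nat.zero_le, true_and]
    constructor
    · rintro ⟨⟨h1, h2⟩, h3, ⟨h4, h5⟩ | ⟨h4, h5⟩⟩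
      · refine Or.inl ⟨d.1.length, lt_of_le_of_ne h5.length_le fun h => h1 ?_,
          Prod.ext (List.prefix_iff_eq_take.mp h5).symm h4⟩
        exact Prod.ext (h5.eq_of_length h) h4.symm
      · refine Or.inr ⟨d.2, lt_of_le_of_ne h4 fun h => h1 (Prod.ext h5 h), Prod.ext h5.symm rfl⟩
    · rintro (⟨l, hl, rfl⟩ | ⟨j, hj, rfl⟩)
      · refine ⟨⟨fun h => ?_, mem_cells_of_le hc.mem_cells (List.take_prefix _ _) le_rfl⟩,
          hc.mem_cells, Or.inl ⟨rfl, List.take_prefix _ _⟩⟩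
        have := congrArg (fun d => d.1.length) h
        simp only [List.length_take] at this
        omega
      · refine ⟨⟨fun h => ?_, mem_cells_of_le hc.mem_cells List.prefix_rfl hj.le⟩,
          hc.mem_cells, Or.inr ⟨hj.le, rfl⟩⟩
        exact hj.ne (congrArg Prod.snd h)
  rw [h, prod_union, prod_image, prod_image]
  · intro j _ j' _ h
    exact congrArg Prod.snd h
  · intro l hl l' hl' h
    simp only [coe_Ico, Set.mem_Ico] at hl hl'
    have := congrArg (fun d => d.1.length) h
    simp only [List.length_take] at this
    omega
  · rw [disjoint_left]
    intro d hd hd'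
    simp only [mem_image, mem_Ico] at hd hd'
    obtain ⟨l, -, rfl⟩ := hd
    obtain ⟨j, hj, h⟩ := hd'
    exact hj.2.ne (congrArg Prod.snd h)

theorem hookLength_pos {S : Shape k} {c} (hc : c ∈ S.cells) : 0 < S.hookLength c :=
  card_pos.mpr ⟨c, self_mem_hook hc⟩

theorem hookBound_pos (S : Shape k) : 0 < S.hookBound := by
  refine div_pos (by exact_mod_cast Nat.factorial_pos _) (prod_pos fun c hc => ?_)
  exact_mod_cast hookLength_pos hc

/-- Each affected hook contributes H / (H - 1) = 1 + 1 / excess, and the factor `S.size` absorbs the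
change of the factorial. -/
theorem IsCorner.hookBound_truncate {S : Shape k} {c} (hc : S.IsCorner c) :
    S.size * (S.truncate c).hookBound = S.hookBound * ∑ d ∈ S.cells, S.walkWeight c d := by
  have h1 : ∏ d ∈ S.cells, (S.hookLength d : ℚ) =
      (∏ d ∈ (S.truncate c).cells, ((S.truncate c).hookLength d : ℚ)) *
        ∑ d ∈ S.cells, S.walkWeight c d := by
    rw [sum_cells_walkWeight hc, ← hc.prod_hook, ← mul_prod_erase _ _ hc.mem_cells, hc.hookLength,
      Nat.cast_one, one_mul, hc.cells_truncate, ← prod_mul_distrib]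
    refine prod_congr rfl fun d hd => ?_
    rw [hc.hookLength_truncate]
    split_ifs with h
    · have h2 := excess_pos (mem_of_mem_erase hd) h (ne_of_mem_erase hd).symm
      have h3 : (S.hookLength d : ℚ) = S.excess d + 1 := by
        rw [Shape.excess]
        ring
      rw [Nat.cast_pred (hookLength_pos (mem_of_mem_erase hd)), h3]
      field_simp
      ring
    · rw [mul_one]
  have h2 : ∏ d ∈ S.cells, (S.hookLength d : ℚ) ≠ 0 :=
    (prod_pos fun c hc => by exact_mod_cast hookLength_pos hc).ne'
  rw [hookBound, hookBound, h1, ← hc.size_truncate, Nat.factorial_succ]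
  rw [h1] at h2
  have h3 := left_ne_zero_of_mul h2
  have h4 := right_ne_zero_of_mul h2
  push_cast
  field_simp

theorem size_mul_sum_hookBound (S : Shape k) :
    S.size * ∑ c ∈ S.corners, (S.truncate c).hookBound =
      S.hookBound * ∑ d ∈ S.cells, S.totalWeight d := by
  rw [mul_sum, sum_congr rfl fun c hc => (mem_corners.mp hc).hookBound_truncate, ← mul_sum]
  simp only [totalWeight]
  rw [sum_comm]

theorem sum_cells_one (S : Shape k) : ∑ _d ∈ S.cells, (1 : ℚ) = S.size := by
  simp [size]

theorem hookBound_le_sum {S : Shape k} (hS : 0 < S.size) :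
    S.hookBound ≤ ∑ c ∈ S.corners, (S.truncate c).hookBound := by
  have h0 : (0 : ℚ) < S.size := by exact_mod_cast hS
  refine le_of_mul_le_mul_left ?_ h0
  rw [size_mul_sum_hookBound, mul_comm, ← sum_cells_one]
  exact mul_le_mul_of_nonneg_left (sum_le_sum S.one_le_totalWeight) S.hookBound_pos.le

theorem hookBound_eq_sum {S : Shape k} (hS : 0 < S.size) (h : ∀ c, S.IsCorner c →
    ∀ d : List (Fin k) × ℕ, d.1 <+: c.1 → d.2 ≤ c.2 → S.ArmsSplit c d) :
    S.hookBound = ∑ c ∈ S.corners, (S.truncate c).hookBound := by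
  have h0 : (S.size : ℚ) ≠ 0 := by exact_mod_cast hS.ne'
  refine mul_left_cancel₀ h0 ?_
  rw [size_mul_sum_hookBound, mul_comm, ← sum_cells_one, sum_congr rfl (totalWeight_eq_one h)]

theorem hookBound_lt_sum {S : Shape k} {c d} (hc : S.IsCorner c)
    (h1 : d.1 <+: c.1) (h2 : d.2 ≤ c.2) (hs : ¬ S.ArmsSplit c d) :
    S.hookBound < ∑ c ∈ S.corners, (S.truncate c).hookBound := by
  refine lt_of_mul_lt_mul_left ?_ (Nat.cast_nonneg (α := ℚ) S.size)
  rw [size_mul_sum_hookBound, mul_comm, ← sum_cells_one]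
  exact mul_lt_mul_of_pos_left (sum_lt_sum S.one_le_totalWeight
    ⟨d, mem_cells_of_le hc.mem_cells h1 h2, one_lt_totalWeight hc h1 h2 hs⟩) S.hookBound_pos

/-! ### Fillings and the removal of the largest entry -/

theorem shape_eq_iff {S : Shape k} {T : HeapTableau k} :
    T.shape = S ↔ ∀ c, T.val c ≠ none ↔ c ∈ S.cells := by
  constructor
  · rintro rfl c
    rw [Shape.mem_cells, T.lt_shape_len_iff]
  · intro h
    ext r
    refine eq_of_forall_lt_iff fun a => ?_
    rw [T.lt_shape_len_iff, h, Shape.mem_cells]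

/-- Pigeonhole: the values from 1 to `S.size` occupy as many distinct cells as there are, leaving
none for another value. -/
theorem fillings_val_mem {S : Shape k} {T : HeapTableau k} (hT : T ∈ S.fillings) {c} {x : ℕ}
    (hx : T.val c = some x) : x ∈ Icc 1 S.size := by
  obtain ⟨hshape, hT⟩ := hT
  have hdom := shape_eq_iff.mp hshape
  choose! f hf hf' using hT
  have hinj : Set.InjOn f (Icc 1 S.size) := by
    intro i hi j hj hij
    have h := hf i hi
    simp only [hij] at h
    exact Option.some_inj.mp (h.symm.trans (hf j hj))
  have himg : (Icc 1 S.size).image f = S.cells := by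
    refine eq_of_subset_of_card_le (image_subset_iff.mpr fun i hi => ?_) ?_
    · rw [← hdom, show T.val (f i) = some i from hf i hi]
      simp
    · rw [card_image_of_injOn hinj, Nat.card_Icc, Nat.add_sub_cancel, size]
  have hc : c ∈ S.cells := by
    rw [← hdom, hx]
    simp
  rw [← himg, mem_image] at hc
  obtain ⟨i, hi, rfl⟩ := hc
  rwa [← Option.some_inj.mp ((hf i hi).symm.trans hx)]

theorem fillings_val_inj {S : Shape k} {T : HeapTableau k} (hT : T ∈ S.fillings) {c d} {x : ℕ}
    (hc : T.val c = some x) (hd : T.val d = some x) : c = d :=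
  (hT.2 x (fillings_val_mem hT hc)).unique hc hd

/-- The heap condition is weak, so a cell below in the same heap could only repeat the maximum;
uniqueness of entries excludes this. -/
theorem isCorner_of_val_eq_size {S : Shape k} {T : HeapTableau k} (hT : T ∈ S.fillings) {c}
    (hc : T.val c = some S.size) : S.IsCorner c := by
  have hdom := shape_eq_iff.mp hT.1
  have hcell := (hdom c).mp (by simp [hc])
  rw [Shape.mem_cells] at hcell
  constructor
  · by_contra hne
    obtain ⟨x, hx⟩ := Option.ne_none_iff_exists'.mp
      ((hdom (c.1, c.2 + 1)).mpr ((S.mem_cells _).mpr (by simp only; omega)))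
    obtain ⟨y, hy, hlt⟩ := T.vec _ _ c.2 x hx (by omega)
    rw [hc, Option.some_inj] at hy
    have := (mem_Icc.mp (fillings_val_mem hT hx)).2
    omega
  · intro r hr hne
    by_contra! hlt
    obtain ⟨x, hx⟩ := Option.ne_none_iff_exists'.mp
      ((hdom (r, c.2)).mpr ((S.mem_cells _).mpr hlt))
    obtain ⟨y, hy, hle⟩ := T.heap _ _ _ x hx hr
    rw [hc, Option.some_inj] at hy
    have h1 := (mem_Icc.mp (fillings_val_mem hT hx)).2
    rw [show x = S.size by omega] at hx
    exact hne (congrArg Prod.fst (fillings_val_inj hT hx hc))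

/-- The heap tableau without its largest entry. -/
def removeMax {S : Shape k} {T : HeapTableau k} (hT : T ∈ S.fillings) {c}
    (hc : T.val c = some S.size) : HeapTableau k where
  val d := if d = c then none else T.val d
  finite_dom := by
    refine T.finite_dom.subset fun d hd h => hd ?_
    simp [h]
  heap q r a x hx hq := by
    split_ifs at hx with hne
    obtain ⟨y, hy, hle⟩ := T.heap q r a x hx hq
    refine ⟨y, ?_, hle⟩
    rw [if_neg, hy]
    rintro rfl
    have h1 := (mem_Icc.mp (fillings_val_mem hT hx)).2
    rw [hy, Option.some_inj] at hc
    rw [show x = y by omega] at hx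
    exact hne (fillings_val_inj hT hx hy)
  vec r a b x hx hb := by
    split_ifs at hx with hne
    obtain ⟨y, hy, hlt⟩ := T.vec r a b x hx hb
    refine ⟨y, ?_, hlt⟩
    rw [if_neg, hy]
    rintro rfl
    have h1 := (mem_Icc.mp (fillings_val_mem hT hx)).2
    rw [hy, Option.some_inj] at hc
    omega

theorem removeMax_mem {S : Shape k} {T : HeapTableau k} (hT : T ∈ S.fillings) {c}
    (hc : T.val c = some S.size) : removeMax hT hc ∈ (S.truncate c).fillings := by
  have hcorner := isCorner_of_val_eq_size hT hc
  have hsize := hcorner.size_truncate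
  refine ⟨shape_eq_iff.mpr fun d => ?_, fun i hi => ?_⟩
  · rw [hcorner.cells_truncate, mem_erase, ← shape_eq_iff.mp hT.1]
    simp [removeMax]
  · rw [mem_Icc] at hi
    obtain ⟨d, hd, huniq⟩ := hT.2 i (mem_Icc.mpr (by omega))
    refine ⟨d, ?_, fun e he => huniq e ?_⟩
    · simp only [removeMax]
      rw [if_neg, hd]
      rintro rfl
      rw [hc, Option.some_inj] at hd
      omega
    · simp only [removeMax] at he
      split_ifs at he
      exact he

/-- The heap tableau with a new largest entry added at the corner `c`. -/
noncomputable def addMax {S : Shape k} {c} (hc : S.IsCorner c) {T : HeapTableau k}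
    (hT : T ∈ (S.truncate c).fillings) : HeapTableau k where
  val d := if d = c then some S.size else T.val d
  finite_dom := by
    refine (T.finite_dom.union (Set.finite_singleton c)).subset fun d hd => ?_
    by_cases h : d = c
    · exact Or.inr h
    · exact Or.inl (by simpa [h] using hd)
  heap q r a x hx hq := by
    have hsize := hc.size_truncate
    split_ifs at hx with h
    · rw [Option.some_inj] at hx
      split_ifs with h'
      · exact ⟨_, rfl, hx.le⟩
      · have h1 : (q, a) ∈ (S.truncate c).cells := by
          rw [hc.cells_truncate]
          exact mem_erase.mpr ⟨h', mem_cells_of_le hc.mem_cells (h ▸ hq) (h ▸ le_rfl)⟩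
        obtain ⟨y, hy⟩ := Option.ne_none_iff_exists'.mp ((shape_eq_iff.mp hT.1 _).mpr h1)
        have := (mem_Icc.mp (fillings_val_mem hT hy)).2
        exact ⟨y, hy, by omega⟩
    · rw [if_neg]
      · exact T.heap q r a x hx hq
      · rintro rfl
        -- The new maximum would lie above an old cell of its heap, contrary to `c` being a corner.
        have h1 := (shape_eq_iff.mp hT.1 (r, a)).mp (by simp [hx])
        rw [hc.cells_truncate, mem_erase, Shape.mem_cells] at h1
        have h2 := hc.2 r hq fun h' => h (by rw [h'])
        simp only at h1 h2
        omega
  vec r a b x hx hb := by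
    have hsize := hc.size_truncate
    split_ifs at hx with h
    · rw [Option.some_inj] at hx
      subst h
      rw [if_neg fun h => hb.ne (congrArg Prod.snd h)]
      have h1 : (r, b) ∈ (S.truncate (r, a)).cells := by
        rw [hc.cells_truncate]
        exact mem_erase.mpr ⟨fun h => hb.ne (congrArg Prod.snd h),
          mem_cells_of_le hc.mem_cells List.prefix_rfl hb.le⟩
      obtain ⟨y, hy⟩ := Option.ne_none_iff_exists'.mp ((shape_eq_iff.mp hT.1 _).mpr h1)
      have := (mem_Icc.mp (fillings_val_mem hT hy)).2
      exact ⟨y, hy, by omega⟩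
    · rw [if_neg]
      · exact T.vec r a b x hx hb
      · rintro rfl
        have h1 := (shape_eq_iff.mp hT.1 (r, a)).mp (by simp [hx])
        rw [hc.cells_truncate, mem_erase, Shape.mem_cells] at h1
        have h2 := hc.1
        simp only at h1 h2
        omega

theorem addMax_mem {S : Shape k} {c} (hc : S.IsCorner c) {T : HeapTableau k}
    (hT : T ∈ (S.truncate c).fillings) : addMax hc hT ∈ S.fillings := by
  have hsize := hc.size_truncate
  have hdom := shape_eq_iff.mp hT.1
  refine ⟨shape_eq_iff.mpr fun d => ?_, fun i hi => ?_⟩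
  · by_cases hd : d = c
    · simp [addMax, hd, hc.mem_cells]
    · simp only [addMax, hd, if_false]
      rw [hdom, hc.cells_truncate, mem_erase, and_iff_right hd]
  · rw [mem_Icc] at hi
    by_cases hin : i = S.size
    · subst hin
      refine ⟨c, by simp [addMax], fun d hd => ?_⟩
      by_contra hne
      simp only [addMax, hne, if_false] at hd
      have := (mem_Icc.mp (fillings_val_mem hT hd)).2
      omega
    · obtain ⟨d, hd, huniq⟩ := hT.2 i (mem_Icc.mpr (by omega))
      refine ⟨d, ?_, fun e he => huniq e ?_⟩
      · simp only [addMax]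
        rw [if_neg, hd]
        rintro rfl
        have h1 := (hdom d).mp (by simp [hd])
        rw [hc.cells_truncate] at h1
        exact ne_of_mem_erase h1 rfl
      · simp only [addMax] at he
        split_ifs at he
        · exact absurd (Option.some_inj.mp he).symm hin
        · exact he

theorem removeMax_inj {S : Shape k} {T T' : HeapTableau k} (hT : T ∈ S.fillings)
    (hT' : T' ∈ S.fillings) {c} (hc : T.val c = some S.size) (hc' : T'.val c = some S.size)
    (h : removeMax hT hc = removeMax hT' hc') : T = T' := by
  ext1
  funext d
  by_cases hd : d = c
  · rw [hd, hc, hc']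
  · simpa [removeMax, hd] using congrArg (fun T => T.val d) h

theorem removeMax_addMax {S : Shape k} {c} (hc : S.IsCorner c) {T : HeapTableau k}
    (hT : T ∈ (S.truncate c).fillings) :
    ∃ h, removeMax (addMax_mem hc hT) (c := c) h = T := by
  refine ⟨by simp [addMax], ?_⟩
  ext1
  funext d
  by_cases hd : d = c
  · have h1 : d ∉ (S.truncate c).cells := by
      rw [hc.cells_truncate, hd]
      exact notMem_erase _ _
    rw [← shape_eq_iff.mp hT.1, not_not] at h1
    simp [removeMax, hd, ← h1]
  · simp [removeMax, addMax, hd]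

theorem fillings_eq_biUnion {S : Shape k} (hS : 0 < S.size) :
    S.fillings = ⋃ c ∈ S.corners, {T | T ∈ S.fillings ∧ T.val c = some S.size} := by
  ext T
  simp only [Set.mem_iUnion, Set.mem_ofPred_eq, exists_prop]
  constructor
  · intro hT
    obtain ⟨c, hc, -⟩ := hT.2 S.size (mem_Icc.mpr ⟨hS, le_rfl⟩)
    exact ⟨c, mem_corners.mpr (isCorner_of_val_eq_size hT hc), hT, hc⟩
  · rintro ⟨-, -, hT, -⟩
    exact hT

theorem ncard_fillings_corner {S : Shape k} {c} (hc : S.IsCorner c) :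
    {T | T ∈ S.fillings ∧ T.val c = some S.size}.ncard = (S.truncate c).numFillings := by
  refine Set.ncard_congr (fun T hT => removeMax hT.1 hT.2) ?_ ?_ ?_
  · exact fun T hT => removeMax_mem hT.1 hT.2
  · exact fun T T' hT hT' h => removeMax_inj hT.1 hT'.1 hT.2 hT'.2 h
  · intro T hT
    obtain ⟨h, h'⟩ := removeMax_addMax hc hT
    exact ⟨addMax hc hT, ⟨addMax_mem hc hT, h⟩, h'⟩

theorem fillings_of_size_eq_zero {S : Shape k} (hS : S.size = 0) :
    ∃ T, S.fillings = {T} := by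
  have hcells : S.cells = ∅ := card_eq_zero.mp hS
  let T₀ : HeapTableau k := ⟨fun _ => none, by simp, by simp, by simp⟩
  refine ⟨T₀, Set.eq_singleton_iff_unique_mem.mpr ⟨⟨?_, by simp [hS]⟩, fun T hT => ?_⟩⟩
  · rw [shape_eq_iff]
    simp [T₀, hcells]
  · ext1
    funext c
    have h := shape_eq_iff.mp hT.1 c
    simpa [hcells] using h

/-- Induction on shapes by removal of corners. -/
theorem corner_induction {P : Shape k → Prop} (zero : ∀ S : Shape k, S.size = 0 → P S)
    (step : ∀ S : Shape k, 0 < S.size → (∀ c, S.IsCorner c → P (S.truncate c)) → P S)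
    (S : Shape k) : P S := by
  induction hn : S.size generalizing S with
  | zero => exact zero S hn
  | succ n ih =>
    refine step S (by omega) fun c hc => ih _ ?_
    have := hc.size_truncate
    omega

/-- Needed because `ncard` is additive over disjoint unions only for finite sets. -/
theorem finite_fillings (S : Shape k) : S.fillings.Finite := by
  induction S using corner_induction with
  | zero S hS =>
    obtain ⟨T, hT⟩ := fillings_of_size_eq_zero hS
    rw [hT]
    exact Set.finite_singleton T
  | step S hS ih =>
    rw [fillings_eq_biUnion hS]
    refine S.corners.finite_toSet.biUnion fun c hc => ?_
    have : Finite (S.truncate c).fillings := ih c (mem_corners.mp hc)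
    exact Finite.of_injective (β := (S.truncate c).fillings)
      (fun T => ⟨removeMax T.2.1 T.2.2, removeMax_mem T.2.1 T.2.2⟩) fun T T' h =>
        Subtype.ext (removeMax_inj T.2.1 T'.2.1 T.2.2 T'.2.2 (congrArg Subtype.val h))

theorem numFillings_eq_sum {S : Shape k} (hS : 0 < S.size) :
    S.numFillings = ∑ c ∈ S.corners, (S.truncate c).numFillings := by
  have h := S.corners.finite_toSet.ncard_biUnion
    (s := fun c => {T | T ∈ S.fillings ∧ T.val c = some S.size})
    (fun c _ => S.finite_fillings.subset fun T hT => hT.1) ?_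
  · rw [finsum_mem_coe_finset] at h
    rw [numFillings, fillings_eq_biUnion hS]
    exact h.trans (sum_congr rfl fun c hc => ncard_fillings_corner (mem_corners.mp hc))
  · intro c _ c' _ hne
    rw [Function.onFun, Set.disjoint_left]
    exact fun T hT hT' => hne (fillings_val_inj hT.1 hT.2 hT'.2)

/-! ### The bound and criteria for tightness -/

theorem hookBound_of_size_eq_zero {S : Shape k} (hS : S.size = 0) :
    S.hookBound = S.numFillings := by
  obtain ⟨T, hT⟩ := fillings_of_size_eq_zero hS
  have hcells : S.cells = ∅ := card_eq_zero.mp hS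
  simp [hookBound, hcells, hS, numFillings, hT]

theorem hookBound_le_numFillings (S : Shape k) : S.hookBound ≤ S.numFillings := by
  induction S using corner_induction with
  | zero S hS => exact (hookBound_of_size_eq_zero hS).le
  | step S hS ih =>
    rw [numFillings_eq_sum hS]
    push_cast
    exact (hookBound_le_sum hS).trans (sum_le_sum fun c hc => ih c (mem_corners.mp hc))

theorem isTight_of_closed {P : Shape k → Prop} (hP : ∀ S c, S.IsCorner c → P S → P (S.truncate c))
    (hsplit : ∀ S, P S → ∀ c, S.IsCorner c → ∀ d : List (Fin k) × ℕ, d.1 <+: c.1 → d.2 ≤ c.2 →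
      S.ArmsSplit c d) (S : Shape k) (hS : P S) : S.IsTight := by
  induction S using corner_induction with
  | zero S h0 => exact (hookBound_of_size_eq_zero h0).symm
  | step S h0 ih =>
    rw [IsTight, numFillings_eq_sum h0, hookBound_eq_sum h0 (hsplit S hS)]
    push_cast
    exact sum_congr rfl fun c hc => ih c (mem_corners.mp hc) (hP S c (mem_corners.mp hc) hS)

/-- Strictness at the first deletion survives, since the lower bound holds for every truncated
shape. -/
theorem not_isTight_of_not_armsSplit {S : Shape k} {c d} (hc : S.IsCorner c)
    (h1 : d.1 <+: c.1) (h2 : d.2 ≤ c.2) (hs : ¬ S.ArmsSplit c d) : ¬ S.IsTight := by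
  have hS : 0 < S.size := by
    have := hc.size_truncate
    omega
  refine ne_of_gt (lt_of_lt_of_le (hookBound_lt_sum hc h1 h2 hs) ?_)
  rw [numFillings_eq_sum hS]
  push_cast
  exact sum_le_sum fun c _ => hookBound_le_numFillings _

/-! ### Families of tight and non-tight shapes -/

/-- The addresses in use form a chain in the prefix order. -/
def IsChainShape (S : Shape k) : Prop :=
  ∀ q r, S.len q ≠ 0 → S.len r ≠ 0 → q <+: r ∨ r <+: q

theorem IsChainShape.isTight {S : Shape k} (hS : S.IsChainShape) : S.IsTight := by
  refine isTight_of_closed (P := IsChainShape) (fun S c _ h q r hq hr => ?_) ?_ S hS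
  · have h1 := S.truncate_len_le c q
    have h2 := S.truncate_len_le c r
    exact h q r (by omega) (by omega)
  · intro S hS c hc d h1 h2 e he
    simp only [armSet, mem_union, mem_image, mem_filter, Shape.mem_cells] at he ⊢
    -- A long vector at `e.1` puts `e` in the arm shifted from heap `c.2`; a short one forces `e.1`
    -- beyond `c.1` on the chain.
    by_cases h : c.2 < S.len e.1
    · exact Or.inl ⟨(e.1, c.2), ⟨h, rfl, he.2.2⟩, Prod.ext rfl he.2.1.symm⟩
    · have h3 := hc.1
      refine Or.inr ⟨he.1, he.2.1, ?_, fun h' => h (by rw [h', h3]; omega)⟩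
      refine (hS e.1 c.1 (by omega) (by omega)).resolve_left fun h' => h ?_
      have := S.anti _ _ h'
      omega

/-- This covers trees and the family `famT` at once. For a corner at the root, `d` has the address
of `c`; for any other corner, `c` and `d` both lie in heap 0. Either way one projected arm is the
whole arm of `d`. -/
theorem isTight_of_len_le_one {S : Shape k} (hS : ∀ r, r ≠ [] → S.len r ≤ 1) : S.IsTight := by
  refine isTight_of_closed (P := fun S => ∀ r, r ≠ [] → S.len r ≤ 1) (fun S c _ h r hr => ?_) ?_ S hS
  · exact (S.truncate_len_le c r).trans (h r hr)
  · intro S hS c hc d h1 h2 e he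
    have h3 := hc.1
    by_cases h : c.1 = []
    · rw [h, List.prefix_nil] at h1
      refine mem_union_right _ ?_
      rwa [h, ← h1]
    · have := hS c.1 h
      refine mem_union_left _ (mem_image.mpr ⟨e, ?_, ?_⟩)
      · rwa [show c.2 = d.2 by omega]
      · rw [← (mem_filter.mp he).2.1]

theorem isChainShape_ofYoung (w : ℕ → Fin k) (μ : YoungDiagram) : (ofYoung w μ).IsChainShape := by
  intro q r hq hr
  simp only [ofYoung, ne_eq, ite_eq_right_iff, not_forall] at hq hr
  obtain ⟨hq, -⟩ := hq
  obtain ⟨hr, -⟩ := hr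
  have key : ∀ a b, (List.range a).map w <+: (List.range (a + b)).map w := fun a b => by
    rw [List.range_add, List.map_append]
    exact List.prefix_append _ _
  have hr' := key r.length q.length
  rw [add_comm, ← hr] at hr'
  have hq' := key q.length r.length
  rw [← hq] at hq'
  exact List.prefix_or_prefix_of_prefix hq' hr'

theorem not_isYoungShape_famT (r : ℕ) (hr : 2 ≤ r) (hk : 2 ≤ k) : ¬ (famT r k).IsYoungShape := by
  rintro ⟨w, μ, h⟩
  have hc := isChainShape_ofYoung w μ
  rw [← h] at hc
  -- Two different one-letter addresses are in use but incomparable.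
  have := hc [⟨0, by omega⟩] [⟨1, by omega⟩]
  simp [famT] at this
  omega

theorem not_isTreeShape_famT (r : ℕ) (hk : 2 ≤ k) : ¬ (famT r k).IsTreeShape := by
  intro h
  have := h []
  simp [famT] at this
  omega

theorem famT_injOn (hk : 2 ≤ k) : Set.InjOn (fun r => famT r k) {r | 2 ≤ r} := by
  have key : ∀ r s, 2 ≤ s → famT r k = famT s k → s ≤ r := by
    intro r s hs h
    have := congrArg (fun S => S.len (List.replicate (s - 1) ⟨0, by omega⟩)) h
    simp only [famT, List.replicate_eq_nil_iff, List.length_replicate] at this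
    split_ifs at this <;> omega
  exact fun r hr s hs h => le_antisymm (key s r hr h.symm) (key r s hs h)

theorem famW_injOn (hk : 2 ≤ k) : Set.InjOn (fun r => famW hk r) {r | 2 ≤ r} := by
  have key : ∀ r s, 2 ≤ s → famW hk r = famW hk s → s ≤ r := by
    intro r s hs h
    -- This address is the deepest one in use in `famW hk s`.
    have := congrArg (fun S => S.len (List.replicate (2 * s - 3) ⟨1, by omega⟩)) h
    obtain ⟨m, hm⟩ : ∃ m, 2 * s - 3 = m + 1 := ⟨2 * s - 4, by omega⟩
    simp only [famW, List.length_replicate, hm, List.replicate_succ, List.cons_ne_nil,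
      List.cons.injEq, Fin.mk.injEq, one_ne_zero, false_and, or_self, if_false, List.length_cons,
      true_and] at this
    split_ifs at this <;> omega
  exact fun r hr s hs h => le_antisymm (key s r hr h.symm) (key r s hs h)

theorem not_isTight_famW (hk : 2 ≤ k) (r : ℕ) (hr : 2 ≤ r) : ¬ (famW hk r).IsTight := by
  have hc : (famW hk r).IsCorner ([⟨0, by omega⟩], 1) := by
    refine ⟨by simp [famW], fun q hq hne => ?_⟩
    have : q ≠ [] := by
      rintro rfl
      simp at hq
    simp only [famW]
    rw [if_neg (by tauto)]
    split_ifs <;> omega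
  -- For the corner at address 0 in the second heap and `d` the root cell, the arm cell at address 1
  -- is missed: its vector has length 1, and it does not extend address 0.
  refine not_isTight_of_not_armsSplit hc (d := ([], 0)) (List.nil_prefix) (by simp) fun h => ?_
  have h1 : (([⟨1, by omega⟩], 0) : List (Fin k) × ℕ) ∈ (famW hk r).armSet ([], 0) := by
    simp only [armSet, mem_filter, Shape.mem_cells]
    simp [famW, show 4 ≤ 2 * r by omega]
  have h2 := h h1
  simp only [armSet, mem_filter, Shape.mem_cells, mem_union, mem_image] at h2
  simp [famW, show 4 ≤ 2 * r by omega] at h2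

end Shape

end HeapTableaux

theorem mainTheorem6 :
    -- the lower bound
    (∀ k : ℕ, 2 ≤ k → ∀ S : HeapTableaux.Shape k, S.hookBound ≤ (S.numFillings : ℚ)) ∧
    -- tightness for Young tableaux
    (∀ k : ℕ, 2 ≤ k → ∀ (w : ℕ → Fin k) (μ : YoungDiagram),
      (HeapTableaux.Shape.ofYoung w μ).IsTight) ∧
    -- tightness for heap-ordered trees
    (∀ k : ℕ, 2 ≤ k → ∀ S : HeapTableaux.Shape k, S.IsTreeShape → S.IsTight) ∧
    -- tightness for the family `T_{r,k}`
    (∀ r k : ℕ, 2 ≤ r → 1 ≤ k → (HeapTableaux.Shape.famT r k).IsTight) ∧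
    -- for every `k ≥ 2` this family is infinite and consists of other shapes than the above
    (∀ k : ℕ, 2 ≤ k →
      (∀ r : ℕ, 2 ≤ r → ¬ (HeapTableaux.Shape.famT r k).IsYoungShape ∧
        ¬ (HeapTableaux.Shape.famT r k).IsTreeShape) ∧
      {S : HeapTableaux.Shape k | ∃ r : ℕ, 2 ≤ r ∧ S = HeapTableaux.Shape.famT r k}.Infinite) ∧
    -- the bound is not tight for the infinite family `W_r`
    (∀ (k : ℕ) (hk : 2 ≤ k),
      (∀ r : ℕ, 2 ≤ r → ¬ (HeapTableaux.Shape.famW hk r).IsTight) ∧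
      {S : HeapTableaux.Shape k |
        ∃ r : ℕ, 2 ≤ r ∧ S = HeapTableaux.Shape.famW hk r}.Infinite) := by
  open HeapTableaux Shape in
  refine ⟨fun k _ S => S.hookBound_le_numFillings,
    fun k _ w μ => (isChainShape_ofYoung w μ).isTight,
    fun k _ S hS => isTight_of_len_le_one fun r _ => hS r,
    fun r k _ _ => isTight_of_len_le_one fun α hα => ?_,
    fun k hk => ⟨fun r hr => ⟨not_isYoungShape_famT r hr hk, not_isTreeShape_famT r hk⟩, ?_⟩,
    fun k hk => ⟨not_isTight_famW hk, ?_⟩⟩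
  · simp only [famT, hα, if_false]
    split_ifs <;> omega
  · refine ((Set.Ici_infinite 2).image (famT_injOn hk)).mono ?_
    rintro _ ⟨r, hr, rfl⟩
    exact ⟨r, hr, rfl⟩
  · refine ((Set.Ici_infinite 2).image (famW_injOn hk)).mono ?_
    rintro _ ⟨r, hr, rfl⟩
    exact ⟨r, hr, rfl⟩
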